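/- **Proposition (Timing processes are Markov).** Let $(X_i)_{i\ge 1}$ be a sequence of independent, identically distributed, (almost surely) positive real random variables on a probability space $(\Omega,\mathcal F,\mathbb P)$. Put $Y_0=0$, $Y_n=\sum_{i=1}^n X_i$ for $n \ge 1$, and define the timing process $$Z_t=\inf\{\,t-Y_n \;:\; n\in\mathbb N_0,\ t-Y_n\ge 0\,\},\qquad t\ge 0.$$ Then $(Z_t)_{t\ge 0}$ is a Markov process: each $Z_t$ is a random variable, and for every $s\ge 0$ and every event $A\in\sigma(Z_u : u\ge s)$, $$\mathbb P\big(A \mid \sigma(Z_u : u\le s)\big)=\mathbb P\big(A\mid \sigma(Z_s)\big)\quad\text{almost surely.}$$ -/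

import Mathlib

open MeasureTheory ProbabilityTheory
open scoped NNReal

/-- The `n`-th renewal time `Y_n`, the sum of the first `n` inter-renewal times. The inter-renewal
times `X_1, X_2, …` are indexed here as `X 0, X 1, …`; thus `Y_0 = 0` and `Y_1 = X 0`. -/
noncomputable def renewalTime {Ω : Type*} (X : ℕ → Ω → ℝ) (n : ℕ) (ω : Ω) : ℝ :=
  ∑ i ∈ Finset.range n, X i ω

/-- The timing process `Z_t = inf {t - Y_n | n ∈ ℕ₀, t - Y_n ≥ 0}`, `t ≥ 0`, with inter-renewal
times `X`. The set contains `t - Y_0 = t` and is bounded below by `0`. -/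
noncomputable def timingProcess {Ω : Type*} (X : ℕ → Ω → ℝ) (t : ℝ≥0) (ω : Ω) : ℝ :=
  sInf {z : ℝ | ∃ n : ℕ, z = (t : ℝ) - renewalTime X n ω ∧ 0 ≤ (t : ℝ) - renewalTime X n ω}

/-- A stochastic process `Z` is a Markov process (with respect to its own filtration) if, for every
present time `s` and every event `A` of the future `σ(Z_u : u ≥ s)`, the conditional probability
of `A` given the past and present `σ(Z_u : u ≤ s)` is almost surely equal to the conditional
probability of `A` given the present state `Z_s`. -/
def IsMarkovProcess {T Ω E : Type*} [Preorder T] [MeasurableSpace E] [MeasurableSpace Ω]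
    (Z : T → Ω → E) (μ : Measure Ω) : Prop :=
  (∀ t, Measurable (Z t)) ∧
    ∀ (s : T) (A : Set Ω),
      MeasurableSet[⨆ (u : T) (_ : s ≤ u), MeasurableSpace.comap (Z u) inferInstance] A →
        μ⟦A | ⨆ (u : T) (_ : u ≤ s), MeasurableSpace.comap (Z u) inferInstance⟧
          =ᵐ[μ] μ⟦A | MeasurableSpace.comap (Z s) inferInstance⟧

/-!
The timing process at time `s` is the age `Z_s = s - Y_n` of the current renewal interval, where
`Y_n ≤ s < Y_{n+1}`; such an `n` exists almost surely because the renewal times are unbounded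
(`TimingProcess.ae_exists_lt_sum`).

On the event that `n` renewals have occurred by time `s`, the path up to time `s` is a function of
the first `n` inter-renewal times (`TimingProcess.age_truncate`), while the path from `s` on is a
function, the same for every `n`, of the age `Z_s` and of the sequence of the remaining
inter-renewal times (`TimingProcess.age_shift`). That sequence is independent of the first `n`
inter-renewal times and has the law of the whole sequence `X`. The event itself says that
`Y_n ≤ s` and that the first remaining inter-renewal time exceeds the age. Hence, given the past,
the conditional probability of a future event is `g (Z_s)`, where `g c` is the conditional
probability, given that `X 0 > c`, that the path restarted at age `c` with the inter-renewal times
`X` lies in the event (`TimingProcess.sectionCond`).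

Since `g` does not depend on `n`, summing over `n` shows that the integral of `g (Z_s)` over every
event `B` of the past is the probability of `A ∩ B`
(`TimingProcess.setLIntegral_sectionCond_timingProcess`). As `g (Z_s)` is measurable with respect
to `Z_s`, it is a version of both conditional probabilities of `A`.
-/

namespace TimingProcess

open Filter
open scoped ENNReal

/-! ### The age of a deterministic path -/

/-- The timing process as a functional of the sequence `x` of inter-renewal times: the time at `t`
since the last renewal. -/
noncomputable def age (t : ℝ≥0) (x : ℕ → ℝ) : ℝ :=
  sInf {z : ℝ | ∃ n : ℕ, z = (t : ℝ) - ∑ i ∈ Finset.range n, x i ∧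
    0 ≤ (t : ℝ) - ∑ i ∈ Finset.range n, x i}

/-- The sequence that agrees with `x` before index `n` and vanishes from `n` on; its partial
sums are those of `x`, stopped at the `n`-th. -/
def truncate (n : ℕ) (x : ℕ → ℝ) : ℕ → ℝ := fun i => if i < n then x i else 0

theorem timingProcess_eq_age {Ω : Type*} (X : ℕ → Ω → ℝ) (t : ℝ≥0) (ω : Ω) :
    timingProcess X t ω = age t (fun i => X i ω) := rfl

theorem age_eq_iInf (t : ℝ≥0) (x : ℕ → ℝ) :
    age t x = ⨅ n : ℕ, if 0 ≤ (t : ℝ) - ∑ i ∈ Finset.range n, x i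
      then (t : ℝ) - ∑ i ∈ Finset.range n, x i else (t : ℝ) := by
  unfold age iInf
  congr 1
  ext z
  simp only [Set.mem_ofPred_eq, Set.mem_range]
  constructor
  · rintro ⟨n, rfl, h⟩
    exact ⟨n, if_pos h⟩
  · rintro ⟨n, rfl⟩
    split_ifs with h
    · exact ⟨n, rfl, h⟩
    · exact ⟨0, by simp⟩

theorem measurable_age : Measurable fun p : ℝ≥0 × (ℕ → ℝ) => age p.1 p.2 := by
  simp_rw [age_eq_iInf]
  refine Measurable.iInf fun n => ?_
  have h : Measurable fun p : ℝ≥0 × (ℕ → ℝ) => (p.1 : ℝ) - ∑ i ∈ Finset.range n, p.2 i := by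
    fun_prop
  exact Measurable.ite (measurableSet_le measurable_const h) h (by fun_prop)

theorem sum_range_truncate (n k : ℕ) (x : ℕ → ℝ) :
    ∑ i ∈ Finset.range k, truncate n x i = ∑ i ∈ Finset.range (min k n), x i := by
  simp only [truncate, ← Finset.sum_filter]
  congr 1
  ext i
  simp

theorem strictMono_sum_range {x : ℕ → ℝ} (hx : ∀ i, 0 < x i) :
    StrictMono fun n => ∑ i ∈ Finset.range n, x i :=
  strictMono_nat_of_lt_succ fun n => by simp [Finset.sum_range_succ, hx n]

/-- Before the renewal with index `n + 1`, the age depends only on the first `n` inter-renewal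
times. -/
theorem age_truncate {x : ℕ → ℝ} (hx : ∀ i, 0 < x i) {n : ℕ} {t : ℝ≥0}
    (h : (t : ℝ) < ∑ i ∈ Finset.range (n + 1), x i) : age t (truncate n x) = age t x := by
  unfold age
  congr 1
  ext z
  simp only [Set.mem_ofPred_eq, sum_range_truncate]
  constructor
  · rintro ⟨k, hk⟩
    exact ⟨min k n, hk⟩
  · rintro ⟨k, hk⟩
    have hkn : k < n + 1 := (strictMono_sum_range hx).lt_iff_lt.1 (by linarith [hk.2])
    exact ⟨k, by rwa [min_eq_left (by omega)]⟩

/-- After the `n`-th renewal, the path of the age restarts with the inter-renewal times from index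
`n` on. -/
theorem age_shift {x : ℕ → ℝ} (hx : ∀ i, 0 < x i) {n : ℕ} {s u : ℝ≥0} (hsu : s ≤ u)
    (h : ∑ i ∈ Finset.range n, x i ≤ (s : ℝ)) :
    age u x = age (u - s + ((s : ℝ) - ∑ i ∈ Finset.range n, x i).toNNReal)
      (fun i => x (n + i)) := by
  have hsu' : (s : ℝ) ≤ u := hsu
  have hu : ((u - s + ((s : ℝ) - ∑ i ∈ Finset.range n, x i).toNNReal : ℝ≥0) : ℝ)
      = u - ∑ i ∈ Finset.range n, x i := by
    rw [NNReal.coe_add, NNReal.coe_sub hsu, Real.coe_toNNReal _ (by linarith)]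
    ring
  have key (k : ℕ) : (u : ℝ) - ∑ i ∈ Finset.range n, x i - ∑ i ∈ Finset.range k, x (n + i)
      = u - ∑ i ∈ Finset.range (n + k), x i := by
    rw [Finset.sum_range_add]; ring
  unfold age
  simp only [hu, key]
  have hb (p : ℕ → ℕ) : BddBelow {z : ℝ | ∃ k : ℕ, z = (u : ℝ) - ∑ i ∈ Finset.range (p k), x i ∧
      0 ≤ (u : ℝ) - ∑ i ∈ Finset.range (p k), x i} :=
    ⟨0, by rintro z ⟨k, rfl, hk⟩; exact hk⟩
  have hn : 0 ≤ (u : ℝ) - ∑ i ∈ Finset.range n, x i := by linarith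
  refine le_antisymm (csInf_le_csInf (hb id) ⟨_, 0, rfl, hn⟩ ?_)
    (le_csInf ⟨_, 0, rfl, by simp⟩ ?_)
  · rintro z ⟨k, hk⟩
    exact ⟨n + k, hk⟩
  · rintro z ⟨k, rfl, hk⟩
    rcases le_total n k with hnk | hkn
    · obtain ⟨j, rfl⟩ := Nat.exists_eq_add_of_le hnk
      exact csInf_le (hb (n + ·)) ⟨j, rfl, hk⟩
    · -- a renewal before the `n`-th one is dominated by the `n`-th one
      refine (csInf_le (hb (n + ·)) ⟨0, rfl, hn⟩).trans ?_
      have := (strictMono_sum_range hx).monotone hkn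
      simp only [add_zero] at this ⊢
      linarith

/-- Between the `n`-th renewal and the next one, the age is the time since the `n`-th renewal. -/
theorem age_eq_sub {x : ℕ → ℝ} (hx : ∀ i, 0 < x i) {n : ℕ} {t : ℝ≥0}
    (h : ∑ i ∈ Finset.range n, x i ≤ (t : ℝ))
    (h' : (t : ℝ) < ∑ i ∈ Finset.range (n + 1), x i) :
    age t x = t - ∑ i ∈ Finset.range n, x i := by
  refine IsLeast.csInf_eq ⟨⟨n, rfl, by linarith⟩, ?_⟩
  rintro z ⟨k, rfl, hk⟩
  have hkn : k < n + 1 := (strictMono_sum_range hx).lt_iff_lt.1 (by linarith)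
  have := (strictMono_sum_range hx).monotone (Nat.lt_succ_iff.1 hkn)
  linarith

theorem exists_sum_range_le_lt {x : ℕ → ℝ} {t : ℝ≥0}
    (h : ∃ n, (t : ℝ) < ∑ i ∈ Finset.range n, x i) :
    ∃ n, ∑ i ∈ Finset.range n, x i ≤ (t : ℝ) ∧ (t : ℝ) < ∑ i ∈ Finset.range (n + 1), x i := by
  classical
  have h0 : Nat.find h ≠ 0 := fun h0 => by
    have := Nat.find_spec h
    rw [h0] at this
    simp only [Finset.range_zero, Finset.sum_empty] at this
    exact absurd this (not_lt.2 t.2)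
  obtain ⟨n, hn⟩ := Nat.exists_eq_succ_of_ne_zero h0
  refine ⟨n, not_lt.1 (Nat.find_min h (by omega)), ?_⟩
  have := Nat.find_spec h
  rwa [hn] at this

/-! ### Divergence of the renewal times -/

variable {Ω : Type*} [MeasurableSpace Ω] {μ : Measure Ω}

/-- The renewal times are almost surely unbounded. The strong law of large numbers is applied to
`min (X i) 1`, because the inter-renewal times need not be integrable. -/
theorem ae_exists_lt_sum [IsProbabilityMeasure μ] {X : ℕ → Ω → ℝ}
    (hX_meas : ∀ i, Measurable (X i)) (hX_indep : iIndepFun X μ)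
    (hX_ident : ∀ i, IdentDistrib (X i) (X 0) μ μ) (hX_pos : ∀ i, ∀ᵐ ω ∂μ, 0 < X i ω) :
    ∀ᵐ ω ∂μ, ∀ c : ℝ, ∃ n, c < ∑ i ∈ Finset.range n, X i ω := by
  have hm : Measurable fun y : ℝ => min y 1 := by fun_prop
  have hpos : ∀ᵐ ω ∂μ, 0 < min (X 0 ω) 1 := by
    filter_upwards [hX_pos 0] with ω h using lt_min h one_pos
  have hint : Integrable (fun ω => min (X 0 ω) 1) μ := by
    refine Integrable.of_bound (hm.comp (hX_meas 0)).aestronglyMeasurable 1 ?_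
    filter_upwards [hpos] with ω h
    rw [Real.norm_eq_abs, abs_of_pos h]
    exact min_le_right _ _
  have hmean : 0 < ∫ ω, min (X 0 ω) 1 ∂μ := by
    rw [integral_pos_iff_support_of_nonneg_ae (hpos.mono fun _ h => h.le) hint]
    have : Function.support (fun ω => min (X 0 ω) 1) =ᵐ[μ] Set.univ :=
      eventuallyEq_univ.2 (hpos.mono fun _ h => h.ne')
    rw [measure_congr this]
    simp
  have hlln := strong_law_ae_real (fun i ω => min (X i ω) 1) hint
    (fun i j hij => (hX_indep.indepFun hij).comp hm hm) (fun i => (hX_ident i).comp hm)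
  filter_upwards [hlln] with ω hω c
  have h1 : Tendsto (fun n : ℕ => ∑ i ∈ Finset.range n, min (X i ω) 1) atTop atTop := by
    refine (hω.pos_mul_atTop hmean tendsto_natCast_atTop_atTop).congr' ?_
    filter_upwards [eventually_ne_atTop 0] with n hn
    have : (n : ℝ) ≠ 0 := by exact_mod_cast hn
    field_simp
  obtain ⟨n, hn⟩ := (h1.eventually_gt_atTop c).exists
  exact ⟨n, hn.trans_le (Finset.sum_le_sum fun i _ => min_le_left _ _)⟩

/-! ### Conditioning on survival -/

/-- The conditional probability of the section of `D` at `c` given the section of `S` at `c`, under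
the law `π`; it is `0` where the section of `S` is null. -/
noncomputable def sectionCond {γ β : Type*} [MeasurableSpace β] (π : Measure β)
    (S D : Set (γ × β)) (c : γ) : ℝ≥0∞ :=
  π (Prod.mk c ⁻¹' (S ∩ D)) / π (Prod.mk c ⁻¹' S)

section

variable {α β γ : Type*} [MeasurableSpace α] [MeasurableSpace β]

theorem measurable_sectionCond [MeasurableSpace γ] {π : Measure β} [SFinite π] {S D : Set (γ × β)}
    (hS : MeasurableSet S) (hD : MeasurableSet D) : Measurable (sectionCond π S D) :=
  (measurable_measure_prodMk_left (hS.inter hD)).div (measurable_measure_prodMk_left hS)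

theorem sectionCond_le_one (π : Measure β) (S D : Set (γ × β)) (c : γ) :
    sectionCond π S D c ≤ 1 :=
  ENNReal.div_le_of_le_mul (by
    rw [one_mul]; exact measure_mono (Set.preimage_mono Set.inter_subset_left))

theorem sectionCond_mul (π : Measure β) [IsFiniteMeasure π] (S D : Set (γ × β)) (c : γ) :
    sectionCond π S D c * π (Prod.mk c ⁻¹' S) = π (Prod.mk c ⁻¹' (S ∩ D)) :=
  ENNReal.div_mul_cancel'
    (fun h => measure_mono_null (Set.preimage_mono Set.inter_subset_left) h)
    (fun h => absurd h (measure_ne_top _ _))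

/-- If `V` is independent of `U`, then on the event that `(a U, V)` lies in `S`, the conditional
probability given `U` that `(a U, V)` lies in `D` is the function `sectionCond` of `a U`. -/
theorem setLIntegral_sectionCond [MeasurableSpace γ] [IsFiniteMeasure μ] {U : Ω → α} {V : Ω → β}
    (hU : Measurable U) (hV : Measurable V) (hUV : U ⟂ᵢ[μ] V) {a : α → γ} (ha : Measurable a)
    {B : Set α} (hB : MeasurableSet B) {S D : Set (γ × β)} (hS : MeasurableSet S)
    (hD : MeasurableSet D) :
    ∫⁻ ω in {ω | U ω ∈ B ∧ (a (U ω), V ω) ∈ S}, sectionCond (μ.map V) S D (a (U ω)) ∂μ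
      = μ {ω | U ω ∈ B ∧ (a (U ω), V ω) ∈ S ∩ D} := by
  have hlaw := (indepFun_iff_map_prod_eq_prod_map_map hU.aemeasurable hV.aemeasurable).1 hUV
  have hm : Measurable fun p : α × β => (a p.1, p.2) := by fun_prop
  have hset {E : Set (γ × β)} (hE : MeasurableSet E) :
      MeasurableSet {p : α × β | p.1 ∈ B ∧ (a p.1, p.2) ∈ E} :=
    (measurable_fst hB).inter (hm hE)
  have hprod {f : γ → ℝ≥0∞} (hf : Measurable f) {E : Set (γ × β)} (hE : MeasurableSet E) :
      ∫⁻ ω in {ω | U ω ∈ B ∧ (a (U ω), V ω) ∈ E}, f (a (U ω)) ∂μ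
        = ∫⁻ u in B, f (a u) * μ.map V (Prod.mk (a u) ⁻¹' E) ∂(μ.map U) := by
    have hfa : Measurable fun p : α × β => f (a p.1) := hf.comp (ha.comp measurable_fst)
    have hpre := setLIntegral_map (μ := μ) (hset hE) hfa (hU.prodMk hV)
    rw [hlaw, ← lintegral_indicator (hset hE),
      lintegral_prod _ (hfa.indicator (hset hE)).aemeasurable] at hpre
    refine hpre.symm.trans ?_
    rw [← lintegral_indicator hB]
    refine lintegral_congr fun u => ?_
    by_cases hu : u ∈ B
    · rw [Set.indicator_of_mem hu, ← lintegral_indicator_const (measurable_prodMk_left hE)]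
      refine lintegral_congr fun v => ?_
      have hmem : (u, v) ∈ {p : α × β | p.1 ∈ B ∧ (a p.1, p.2) ∈ E} ↔
          v ∈ Prod.mk (a u) ⁻¹' E := and_iff_right hu
      by_cases hv : v ∈ Prod.mk (a u) ⁻¹' E
      · rw [Set.indicator_of_mem (hmem.2 hv), Set.indicator_of_mem hv]
      · rw [Set.indicator_of_notMem (mt hmem.1 hv), Set.indicator_of_notMem hv]
    · simp [hu, Set.indicator]
  have h1 := hprod (measurable_const (a := (1 : ℝ≥0∞))) (hS.inter hD)
  rw [setLIntegral_one] at h1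
  rw [h1, hprod (measurable_sectionCond hS hD) hS]
  simp_rw [sectionCond_mul, one_mul]

end

/-- The characterization of a conditional probability by its integrals, for a version with values
in `ℝ≥0∞`. -/
theorem condExp_indicator_ae_eq {Ω : Type*} {m m₀ : MeasurableSpace Ω} {μ : Measure Ω}
    [IsFiniteMeasure μ] (hm : m ≤ m₀) {A : Set Ω} (hA : MeasurableSet[m₀] A) {f : Ω → ℝ≥0∞}
    (hf : Measurable[m] f) (hf1 : ∀ ω, f ω ≤ 1)
    (h : ∀ B, MeasurableSet[m] B → ∫⁻ ω in B, f ω ∂μ = μ (A ∩ B)) :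
    μ⟦A | m⟧ =ᵐ[μ] fun ω => (f ω).toReal := by
  have hfm : Measurable[m] fun ω => (f ω).toReal := hf.ennreal_toReal
  have hint : Integrable (fun ω => (f ω).toReal) μ := by
    refine Integrable.of_bound (hfm.mono hm le_rfl).aestronglyMeasurable 1 (ae_of_all _ fun ω => ?_)
    rw [Real.norm_eq_abs, abs_of_nonneg ENNReal.toReal_nonneg]
    exact ENNReal.toReal_mono ENNReal.one_ne_top (hf1 ω)
  refine (ae_eq_condExp_of_forall_setIntegral_eq hm ((integrable_const (1 : ℝ)).indicator hA)
    (fun _ _ _ => hint.integrableOn) (fun B hB _ => ?_)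
    hfm.stronglyMeasurable.aestronglyMeasurable).symm
  rw [integral_toReal (hf.mono hm le_rfl).aemeasurable
    (ae_of_all _ fun ω => (hf1 ω).trans_lt ENNReal.one_lt_top), h B hB,
    integral_indicator_const _ hA]
  simp [Measure.real, Measure.restrict_apply hA]

/-! ### The renewal sequence -/

/-- A sequence of independent identically distributed variables has the same law as its shifts. -/
theorem map_shift_eq {X : ℕ → Ω → ℝ} (hX_indep : iIndepFun X μ)
    (hX_ident : ∀ i, IdentDistrib (X i) (X 0) μ μ) (n : ℕ) :
    μ.map (fun ω i => X (n + i) ω) = μ.map (fun ω i => X i ω) :=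
  (IdentDistrib.pi (fun i => (hX_ident (n + i)).trans (hX_ident i).symm)
    (hX_indep.precomp (add_right_injective n)) hX_indep).map_eq

theorem indepFun_truncate_shift {X : ℕ → Ω → ℝ} (hX_meas : ∀ i, Measurable (X i))
    (hX_indep : iIndepFun X μ) (n : ℕ) :
    (fun ω => truncate n fun i => X i ω) ⟂ᵢ[μ] (fun ω i => X (n + i) ω) := by
  have h := indep_iSup_of_disjoint (fun i => (hX_meas i).comap_le) hX_indep
    (Set.disjoint_left.2 fun i (hi : i ∈ Set.Iio n) (hi' : i ∈ Set.Ici n) =>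
      not_le.2 (Set.mem_Iio.1 hi) (Set.mem_Ici.1 hi'))
  rw [IndepFun_iff_Indep]
  refine indep_of_indep_of_le_left (indep_of_indep_of_le_right h ?_) ?_
  · simp only [MeasurableSpace.pi, MeasurableSpace.comap_iSup, MeasurableSpace.comap_comp]
    exact iSup_le fun i => le_iSup₂_of_le (n + i) (Nat.le_add_right n i) le_rfl
  · simp only [MeasurableSpace.pi, MeasurableSpace.comap_iSup, MeasurableSpace.comap_comp]
    refine iSup_le fun i => ?_
    by_cases hi : i < n
    · refine le_iSup₂_of_le i hi (le_of_eq ?_)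
      congr 1
      ext ω
      simp [truncate, hi]
    · refine Measurable.comap_le ?_
      have : ((fun x : ℕ → ℝ => x i) ∘ fun ω => truncate n fun i => X i ω) = fun _ => 0 := by
        ext ω
        simp [truncate, hi]
      rw [this]
      exact measurable_const

theorem measurable_truncate (n : ℕ) : Measurable (truncate n) := by
  refine measurable_pi_iff.2 fun i => ?_
  unfold truncate
  split_ifs <;> fun_prop

theorem iSup_comap_eq_comap_pi {Ω T E : Type*} [MeasurableSpace E] (Z : T → Ω → E)
    (p : T → Prop) :
    (⨆ (u : T) (_ : p u), MeasurableSpace.comap (Z u) inferInstance)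
      = MeasurableSpace.comap (fun ω (u : {u // p u}) => Z u ω) inferInstance := by
  simp only [MeasurableSpace.pi, MeasurableSpace.comap_iSup, MeasurableSpace.comap_comp,
    iSup_subtype]
  rfl

/-! ### The Markov property -/

/-- The pairs of an age and a sequence of inter-renewal times for which the first inter-renewal
time exceeds the age. -/
def survival : Set (ℝ≥0 × (ℕ → ℝ)) := {p | (p.1 : ℝ) < p.2 0}

theorem measurableSet_survival : MeasurableSet survival :=
  measurableSet_lt (by fun_prop) (by fun_prop)

/-- The path from time `s` on of the timing process, as a function of the age at time `s` and of
the inter-renewal times from the current one on. -/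
noncomputable def futurePath (s : ℝ≥0) (p : ℝ≥0 × (ℕ → ℝ)) : {u : ℝ≥0 // s ≤ u} → ℝ :=
  fun u => age (u - s + p.1) p.2

theorem measurable_futurePath (s : ℝ≥0) : Measurable (futurePath s) := by
  refine measurable_pi_iff.2 fun u => ?_
  have h : Measurable fun p : ℝ≥0 × (ℕ → ℝ) => ((u : ℝ≥0) - s + p.1, p.2) :=
    (measurable_const.add measurable_fst).prodMk measurable_snd
  simpa only [futurePath, Function.comp_def] using measurable_age.comp h

theorem measurable_timingProcess {X : ℕ → Ω → ℝ} (hX_meas : ∀ i, Measurable (X i)) (t : ℝ≥0) :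
    Measurable (timingProcess X t) :=
  measurable_age.comp (measurable_const.prodMk (measurable_pi_iff.2 hX_meas))

/-- The event that exactly `n` renewals have occurred by time `s`, for positive inter-renewal
times. -/
def renewalCountEvent (X : ℕ → Ω → ℝ) (s : ℝ≥0) (n : ℕ) : Set Ω :=
  {ω | ∑ i ∈ Finset.range n, X i ω ≤ (s : ℝ) ∧ (s : ℝ) < ∑ i ∈ Finset.range (n + 1), X i ω}

theorem measurableSet_renewalCountEvent {X : ℕ → Ω → ℝ} (hX_meas : ∀ i, Measurable (X i))
    (s : ℝ≥0) (n : ℕ) : MeasurableSet (renewalCountEvent X s n) := by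
  have h (k : ℕ) : Measurable fun ω => ∑ i ∈ Finset.range k, X i ω :=
    Finset.measurable_sum _ fun i _ => hX_meas i
  exact (measurableSet_le (h n) measurable_const).inter
    (measurableSet_lt measurable_const (h (n + 1)))

/-- On the event that exactly `n` renewals have occurred by time `s`, the past is a function of the
first `n` inter-renewal times and the future a function of the age and the remaining ones, so that
independence gives the conditional probability of the future as a function of the age. -/
theorem setLIntegral_renewalCountEvent [IsProbabilityMeasure μ] {X : ℕ → Ω → ℝ}
    (hX_meas : ∀ i, Measurable (X i)) (hX_indep : iIndepFun X μ)
    (hX_ident : ∀ i, IdentDistrib (X i) (X 0) μ μ) (hX_pos : ∀ᵐ ω ∂μ, ∀ i, 0 < X i ω)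
    (s : ℝ≥0) (n : ℕ) {C : Set ({u : ℝ≥0 // u ≤ s} → ℝ)} (hC : MeasurableSet C)
    {D : Set ({u : ℝ≥0 // s ≤ u} → ℝ)} (hD : MeasurableSet D) :
    ∫⁻ ω in {ω | (fun u : {u : ℝ≥0 // u ≤ s} => timingProcess X u ω) ∈ C}
        ∩ renewalCountEvent X s n,
      sectionCond (μ.map fun ω i => X i ω) survival (futurePath s ⁻¹' D)
        (timingProcess X s ω).toNNReal ∂μ
      = μ ({ω | (fun u : {u : ℝ≥0 // s ≤ u} => timingProcess X u ω) ∈ D}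
        ∩ {ω | (fun u : {u : ℝ≥0 // u ≤ s} => timingProcess X u ω) ∈ C}
        ∩ renewalCountEvent X s n) := by
  have hX : Measurable fun ω i => X i ω := measurable_pi_iff.2 hX_meas
  set U : Ω → ℕ → ℝ := fun ω => truncate n fun i => X i ω with hU_def
  set V : Ω → ℕ → ℝ := fun ω i => X (n + i) ω with hV_def
  set a : (ℕ → ℝ) → ℝ≥0 := fun x => ((s : ℝ) - ∑ i ∈ Finset.range n, x i).toNNReal with ha_def
  set B : Set (ℕ → ℝ) := {x | ∑ i ∈ Finset.range n, x i ≤ (s : ℝ)} ∩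
    (fun x (u : {u : ℝ≥0 // u ≤ s}) => age u x) ⁻¹' C with hB_def
  have hU : Measurable U := (measurable_truncate n).comp hX
  have hV : Measurable V := measurable_pi_iff.2 fun i => hX_meas (n + i)
  have ha : Measurable a := by fun_prop
  have hB : MeasurableSet B :=
    (measurableSet_le (by fun_prop) (by fun_prop)).inter
      (measurable_pi_iff.2 (fun u => measurable_age.comp measurable_prodMk_left) hC)
  have hsumU (ω : Ω) : ∑ i ∈ Finset.range n, U ω i = ∑ i ∈ Finset.range n, X i ω := by
    rw [hU_def, sum_range_truncate, min_self]
  have haU (ω : Ω) : a (U ω) = ((s : ℝ) - ∑ i ∈ Finset.range n, X i ω).toNNReal := by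
    rw [ha_def]; simp only [hsumU]
  have hcount (ω : Ω) : ω ∈ renewalCountEvent X s n ↔
      ∑ i ∈ Finset.range n, U ω i ≤ s ∧ (a (U ω), V ω) ∈ survival := by
    rw [hsumU]
    refine and_congr_right fun h => ?_
    change _ ↔ ((a (U ω) : ℝ≥0) : ℝ) < X (n + 0) ω
    rw [haU, Real.coe_toNNReal _ (sub_nonneg.2 h), Finset.sum_range_succ, sub_lt_iff_lt_add',
      add_zero]
  have hpast {ω : Ω} (hω : ∀ i, 0 < X i ω) (hn : ω ∈ renewalCountEvent X s n) :
      (fun u : {u : ℝ≥0 // u ≤ s} => age u (U ω))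
        = fun u : {u : ℝ≥0 // u ≤ s} => timingProcess X u ω := by
    ext u
    exact age_truncate hω (lt_of_le_of_lt (NNReal.coe_le_coe.2 u.2) hn.2)
  have hfuture {ω : Ω} (hω : ∀ i, 0 < X i ω) (hn : ω ∈ renewalCountEvent X s n) :
      futurePath s (a (U ω), V ω) = fun u : {u : ℝ≥0 // s ≤ u} => timingProcess X u ω := by
    ext u
    rw [futurePath, haU]
    exact (age_shift hω u.2 hn.1).symm
  -- almost surely, the events of the past and of the future are events of `U` and of `(a U, V)`
  have hE : ({ω | (fun u : {u : ℝ≥0 // u ≤ s} => timingProcess X u ω) ∈ C}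
      ∩ renewalCountEvent X s n : Set Ω) =ᵐ[μ] {ω | U ω ∈ B ∧ (a (U ω), V ω) ∈ survival} := by
    rw [eventuallyEq_set]
    filter_upwards [hX_pos] with ω hω
    constructor
    · rintro ⟨hC, hn⟩
      obtain ⟨h1, h2⟩ := (hcount ω).1 hn
      refine ⟨⟨h1, ?_⟩, h2⟩
      rw [Set.mem_preimage, hpast hω hn]
      exact hC
    · rintro ⟨⟨h1, h2⟩, h3⟩
      have hn := (hcount ω).2 ⟨h1, h3⟩
      rw [Set.mem_preimage, hpast hω hn] at h2
      exact ⟨h2, hn⟩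
  have hE' : ({ω | (fun u : {u : ℝ≥0 // s ≤ u} => timingProcess X u ω) ∈ D}
      ∩ {ω | (fun u : {u : ℝ≥0 // u ≤ s} => timingProcess X u ω) ∈ C}
      ∩ renewalCountEvent X s n : Set Ω) =ᵐ[μ]
      {ω | U ω ∈ B ∧ (a (U ω), V ω) ∈ survival ∩ futurePath s ⁻¹' D} := by
    rw [eventuallyEq_set] at hE ⊢
    filter_upwards [hX_pos, hE] with ω hω hEω
    constructor
    · rintro ⟨⟨hD, hC⟩, hn⟩
      obtain ⟨h1, h2⟩ := hEω.1 ⟨hC, hn⟩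
      refine ⟨h1, h2, ?_⟩
      rw [Set.mem_preimage, hfuture hω hn]
      exact hD
    · rintro ⟨h1, h2, h3⟩
      obtain ⟨hC, hn⟩ := hEω.2 ⟨h1, h2⟩
      rw [Set.mem_preimage, hfuture hω hn] at h3
      exact ⟨⟨h3, hC⟩, hn⟩
  rw [measure_congr hE', setLIntegral_congr hE, ← setLIntegral_sectionCond hU hV
    (indepFun_truncate_shift hX_meas hX_indep n) ha hB measurableSet_survival
    (measurable_futurePath s hD), hV_def, map_shift_eq hX_indep hX_ident]
  refine setLIntegral_congr_fun_ae ((hU hB).inter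
    (((ha.comp hU).prodMk hV) measurableSet_survival)) ?_
  filter_upwards [hX_pos, eventuallyEq_set.1 hE] with ω hω hEω hmem
  have hn := (hEω.2 hmem).2
  rw [haU, timingProcess_eq_age, age_eq_sub hω hn.1 hn.2]

theorem aedisjoint_renewalCountEvent {X : ℕ → Ω → ℝ} (hX_pos : ∀ᵐ ω ∂μ, ∀ i, 0 < X i ω)
    (s : ℝ≥0) : Pairwise (Function.onFun (AEDisjoint μ) (renewalCountEvent X s)) := by
  intro m n hmn
  refine measure_eq_zero_iff_ae_notMem.2 ?_
  filter_upwards [hX_pos] with ω hω ⟨hm, hn⟩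
  have h1 : m < n + 1 := (strictMono_sum_range hω).lt_iff_lt.1 (hm.1.trans_lt hn.2)
  have h2 : n < m + 1 := (strictMono_sum_range hω).lt_iff_lt.1 (hn.1.trans_lt hm.2)
  omega

/-- For an event `A` of the future and an event `B` of the past, the probability of `A ∩ B` is the
integral over `B` of a function of the age alone. -/
theorem setLIntegral_sectionCond_timingProcess [IsProbabilityMeasure μ] {X : ℕ → Ω → ℝ}
    (hX_meas : ∀ i, Measurable (X i)) (hX_indep : iIndepFun X μ)
    (hX_ident : ∀ i, IdentDistrib (X i) (X 0) μ μ) (hX_pos : ∀ i, ∀ᵐ ω ∂μ, 0 < X i ω)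
    (s : ℝ≥0) {C : Set ({u : ℝ≥0 // u ≤ s} → ℝ)} (hC : MeasurableSet C)
    {D : Set ({u : ℝ≥0 // s ≤ u} → ℝ)} (hD : MeasurableSet D) :
    ∫⁻ ω in {ω | (fun u : {u : ℝ≥0 // u ≤ s} => timingProcess X u ω) ∈ C},
      sectionCond (μ.map fun ω i => X i ω) survival (futurePath s ⁻¹' D)
        (timingProcess X s ω).toNNReal ∂μ
      = μ ({ω | (fun u : {u : ℝ≥0 // s ≤ u} => timingProcess X u ω) ∈ D}
        ∩ {ω | (fun u : {u : ℝ≥0 // u ≤ s} => timingProcess X u ω) ∈ C}) := by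
  have hpos : ∀ᵐ ω ∂μ, ∀ i, 0 < X i ω := ae_all_iff.2 hX_pos
  have hZ := measurable_timingProcess hX_meas
  have hcover (E : Set Ω) : E =ᵐ[μ] (⋃ n, E ∩ renewalCountEvent X s n : Set Ω) := by
    rw [eventuallyEq_set]
    filter_upwards [ae_exists_lt_sum hX_meas hX_indep hX_ident hX_pos] with ω hω
    obtain ⟨n, hn⟩ := exists_sum_range_le_lt (hω s)
    rw [← Set.inter_iUnion]
    exact ⟨fun h => ⟨h, Set.mem_iUnion.2 ⟨n, hn⟩⟩, fun h => h.1⟩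
  have hdisj (E : Set Ω) :
      Pairwise (Function.onFun (AEDisjoint μ) fun n => E ∩ renewalCountEvent X s n) :=
    fun m n hmn => (aedisjoint_renewalCountEvent hpos s hmn).mono Set.inter_subset_right
      Set.inter_subset_right
  have hmeas {E : Set Ω} (hE : MeasurableSet E) (n : ℕ) :
      NullMeasurableSet (E ∩ renewalCountEvent X s n) μ :=
    (hE.inter (measurableSet_renewalCountEvent hX_meas s n)).nullMeasurableSet
  have hpast : MeasurableSet
      {ω | (fun u : {u : ℝ≥0 // u ≤ s} => timingProcess X u ω) ∈ C} :=
    (measurable_pi_iff.2 fun u : {u : ℝ≥0 // u ≤ s} => hZ u) hC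
  have hfuture : MeasurableSet
      {ω | (fun u : {u : ℝ≥0 // s ≤ u} => timingProcess X u ω) ∈ D} :=
    (measurable_pi_iff.2 fun u : {u : ℝ≥0 // s ≤ u} => hZ u) hD
  rw [setLIntegral_congr (hcover _), lintegral_iUnion₀ (hmeas hpast) (hdisj _),
    measure_congr (hcover _), measure_iUnion₀ (hdisj _) (hmeas (hfuture.inter hpast))]
  exact tsum_congr fun n =>
    setLIntegral_renewalCountEvent hX_meas hX_indep hX_ident hpos s n hC hD

end TimingProcess

open TimingProcess in
theorem mainTheorem6 {Ω : Type*} [MeasurableSpace Ω] (μ : Measure Ω) [IsProbabilityMeasure μ]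
    (X : ℕ → Ω → ℝ)
    (hX_meas : ∀ i, Measurable (X i))
    (hX_indep : iIndepFun X μ)
    (hX_ident : ∀ i, IdentDistrib (X i) (X 0) μ μ)
    (hX_pos : ∀ i, ∀ᵐ ω ∂μ, 0 < X i ω) :
    IsMarkovProcess (timingProcess X) μ := by
  have hZ := measurable_timingProcess hX_meas
  refine ⟨hZ, fun s A hA => ?_⟩
  have hpast : Measurable fun ω (u : {u : ℝ≥0 // u ≤ s}) => timingProcess X u ω :=
    measurable_pi_iff.2 fun u => hZ u
  have hfuture : Measurable fun ω (u : {u : ℝ≥0 // s ≤ u}) => timingProcess X u ω :=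
    measurable_pi_iff.2 fun u => hZ u
  rw [iSup_comap_eq_comap_pi] at hA ⊢
  obtain ⟨D, hD, rfl⟩ := hA
  set f : Ω → ENNReal := fun ω => sectionCond (μ.map fun ω i => X i ω) survival
    (futurePath s ⁻¹' D) (timingProcess X s ω).toNNReal with hf_def
  have hle : MeasurableSpace.comap (timingProcess X s) inferInstance ≤
      MeasurableSpace.comap (fun ω (u : {u : ℝ≥0 // u ≤ s}) => timingProcess X u ω)
        inferInstance := by
    rw [← iSup_comap_eq_comap_pi]
    exact le_iSup₂_of_le s le_rfl le_rfl
  have hf : Measurable[MeasurableSpace.comap (timingProcess X s) inferInstance] f :=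
    (measurable_sectionCond measurableSet_survival (measurable_futurePath s hD)).comp
      (measurable_real_toNNReal.comp (comap_measurable _))
  have hf1 (ω : Ω) : f ω ≤ 1 := sectionCond_le_one _ _ _ _
  have hint (B : Set Ω) (hB : MeasurableSet[MeasurableSpace.comap
      (fun ω (u : {u : ℝ≥0 // u ≤ s}) => timingProcess X u ω) inferInstance] B) :
      ∫⁻ ω in B, f ω ∂μ = μ ((fun ω (u : {u : ℝ≥0 // s ≤ u}) => timingProcess X u ω) ⁻¹' D ∩ B) := by
    obtain ⟨C, hC, rfl⟩ := hB
    exact setLIntegral_sectionCond_timingProcess hX_meas hX_indep hX_ident hX_pos s hC hD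
  -- both conditional probabilities are the same function of `Z_s`
  exact (condExp_indicator_ae_eq hpast.comap_le (hfuture hD) (hf.mono hle le_rfl) hf1 hint).trans
    (condExp_indicator_ae_eq (hZ s).comap_le (hfuture hD) hf hf1 fun B hB =>
      hint B (hle B hB)).symm
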